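/- A virtual link diagram is the image of an immersion of ordered and oriented circles in the plane whose transverse double points are classical crossings (with over/under information) or virtual crossings. The welded Reidemeister moves are the Reidemeister moves R1, R2, R3, the virtual moves VR1, VR2, VR3 (R1, R2, R3 with all crossings virtual), VR4 (a strand having only virtual crossings passes across a classical crossing) and the move OC (a strand passing over two other strands passes across the virtual crossing of these two), for all orientations of the strands and up to isotopy of the plane. Let $n$ be an odd positive integer. The $V(n)$-move is the local move, performed in a disk, that exchanges two parallel strands without crossings, oriented in the same direction, with the same two strands forming one virtual crossing followed by $n$ consecutive classical half twists (all in the same sense). The $\overline{V}(n)$-move is the same local move with the two strands oriented antiparallel. Then the $V(n)$-move and the $\overline{V}(n)$-move are equivalent: two diagrams related by a single $V(n)$-move are related by a finite sequence of $\overline{V}(n)$-moves and welded Reidemeister moves, and two diagrams related by a single $\overline{V}(n)$-move are related by a finite sequence of $V(n)$-moves and welded Reidemeister moves. This holds for each choice of the sense (handedness) of the half twists and for each choice of the orientation of the strands (both upwards or both downwards for $V(n)$; left strand upwards or left strand downwards for $\overline{V}(n)$), made independently for the two moves. -/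

import Mathlib

/-!
Virtual link diagrams in the plane, welded Reidemeister moves and the V-moves.

A diagram is put in general position with respect to the height function and cut into horizontal
layers, each of which contains exactly one crossing, local minimum or local maximum.  Two such
layered pictures show planar isotopic diagrams if and only if they are related by the relations
collected in `Planar`.
-/

namespace WeldedLink

/-- The three kinds of a double point, drawn as an `X`.
`over`: classical, the branch from bottom left to top right is the overpass;
`under`: classical, the branch from bottom left to top right is the underpass;
`virt`: virtual. -/
inductive Kind
  | over
  | under
  | virt

/-- Exchange over and under information; a virtual crossing stays virtual. -/
def Kind.flip : Kind → Kind
  | .over => .under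
  | .under => .over
  | .virt => .virt

/-- A strand of a diagram at a fixed height: whether it is oriented upwards or downwards there, and
the name of the circle it belongs to. -/
@[ext]
structure Strand (C : Type*) where
  up : Bool
  color : C

/-- The same strand with the opposite vertical direction. -/
def Strand.rev {C : Type*} (a : Strand C) : Strand C := ⟨!a.up, a.color⟩

/-- Elementary pieces, read from bottom to top. `cross k a b` is a crossing of kind `k` between the
branch `a` from bottom left to top right and the branch `b` from bottom right to top left.
`cup a` is a local minimum whose left leg is `a`, `cap a` is a local maximum whose left leg
is `a`. -/
inductive Piece (C : Type*)
  | cross (k : Kind) (a b : Strand C)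
  | cup (a : Strand C)
  | cap (a : Strand C)

/-- The strands at the bottom of a piece, from left to right. -/
def Piece.bot {C : Type*} : Piece C → List (Strand C)
  | .cross _ a b => [a, b]
  | .cup _ => []
  | .cap a => [a, a.rev]

/-- The strands at the top of a piece, from left to right. -/
def Piece.top {C : Type*} : Piece C → List (Strand C)
  | .cross _ a b => [b, a]
  | .cup a => [a, a.rev]
  | .cap _ => []

/-- A horizontal layer: one elementary piece with vertical strands to its left and right. -/
structure Layer (C : Type*) where
  left : List (Strand C)
  piece : Piece C
  right : List (Strand C)

/-- The strands at the bottom of a layer. -/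
def Layer.bot {C : Type*} (x : Layer C) : List (Strand C) := x.left ++ x.piece.bot ++ x.right

/-- The strands at the top of a layer. -/
def Layer.top {C : Type*} (x : Layer C) : List (Strand C) := x.left ++ x.piece.top ++ x.right

/-- A stack of layers, listed from bottom to top. -/
abbrev Stack (C : Type*) := List (Layer C)

/-- Consecutive layers of the stack `w` fit together, orientations and names of circles included,
and `w` starts with the strands `s` at the bottom and ends with the strands `t` at the top. -/
def Stack.Runs {C : Type*} (s : List (Strand C)) : Stack C → List (Strand C) → Prop
  | [], t => s = t
  | x :: w, t => s = x.bot ∧ Stack.Runs x.top w t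

/-- Put vertical strands to the left and to the right of a whole stack. -/
def Stack.place {C : Type*} (l : List (Strand C)) (w : Stack C) (r : List (Strand C)) : Stack C :=
  w.map fun x => ⟨l ++ x.left, x.piece, x.right ++ r⟩

/-- An oriented virtual link diagram whose circles carry names in `C`.  A `μ`-component diagram
with ordered components is the case `C = Fin μ` where each name is carried by exactly one circle;
names are carried along circles, so the moves below transport the order of the components. -/
structure Diagram (C : Type*) where
  stack : Stack C
  closed : Stack.Runs [] stack []

/-- A local move, given by the pairs of pictures in a disk that it exchanges. -/
abbrev LocalMove (C : Type*) := Stack C → Stack C → Prop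

/-- `D'` is obtained from `D` by replacing, in a disk, the first picture of a pair in `M` by the
second one, everything outside the disk being unchanged. -/
def Step {C : Type*} (M : LocalMove C) (D D' : Diagram C) : Prop :=
  ∃ (x y : Stack C) (p q : Stack C) (l r : List (Strand C)), M x y ∧
    D.stack = p ++ Stack.place l x r ++ q ∧ D'.stack = p ++ Stack.place l y r ++ q

/-- Isotopies of the plane: pieces far apart change heights, a neighbouring maximum and minimum
cancel, and a crossing is turned past a maximum or a minimum. -/
inductive Planar {C : Type*} : LocalMove C
  | exchange (g h : Piece C) (m : List (Strand C)) :
      Planar [⟨[], g, m ++ h.bot⟩, ⟨g.top ++ m, h, []⟩]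
        [⟨g.bot ++ m, h, []⟩, ⟨[], g, m ++ h.top⟩]
  | zigzag_left (a : Strand C) :
      Planar [⟨[a], .cup a.rev, []⟩, ⟨[], .cap a, [a]⟩] []
  | zigzag_right (a : Strand C) :
      Planar [⟨[], .cup a, [a]⟩, ⟨[a], .cap a.rev, []⟩] []
  | cap_slide (k : Kind) (a b : Strand C) :
      Planar [⟨[a], .cross k b a.rev, []⟩, ⟨[], .cap a, [b]⟩]
        [⟨[], .cross k.flip a b, [a.rev]⟩, ⟨[b], .cap a, []⟩]
  | cup_slide (k : Kind) (a b : Strand C) :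
      Planar [⟨[b], .cup a, []⟩, ⟨[], .cross k b a, [a.rev]⟩]
        [⟨[], .cup a, [b]⟩, ⟨[a], .cross k.flip a.rev b, []⟩]

/-- The admissible triangles for moves of the type of the third Reidemeister move.  Three strands
1, 2, 3, numbered from left to right at the bottom, cross pairwise and appear in the order 3, 2, 1
at the top; `Triangle k₁₂ k₁₃ k₂₃` says that the strands `i < j` may cross in the kind `kᵢⱼ`, where
`over` means that strand `i` is over strand `j`. -/
inductive Triangle : Kind → Kind → Kind → Prop
  /-- R3: three classical crossings, with one strand on top, one in the middle, one at the
  bottom (the two cyclic configurations are excluded) -/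
  | r3 (k₁₂ k₁₃ k₂₃ : Kind) (h₁₂ : k₁₂ ≠ .virt) (h₁₃ : k₁₃ ≠ .virt) (h₂₃ : k₂₃ ≠ .virt)
      (acyclic : k₁₂ = k₂₃ → k₁₃ = k₁₂) : Triangle k₁₂ k₁₃ k₂₃
  /-- VR3 -/
  | vr3 : Triangle .virt .virt .virt
  /-- VR4: a strand with two virtual crossings passes a classical crossing -/
  | vr4_12 (k : Kind) (h : k ≠ .virt) : Triangle k .virt .virt
  | vr4_13 (k : Kind) (h : k ≠ .virt) : Triangle .virt k .virt
  | vr4_23 (k : Kind) (h : k ≠ .virt) : Triangle .virt .virt k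
  /-- OC: a strand lying over two strands passes the virtual crossing of these -/
  | oc_1 : Triangle .over .over .virt
  | oc_2 : Triangle .under .virt .over
  | oc_3 : Triangle .virt .under .under

/-- The welded Reidemeister moves: R1, R2, R3, VR1, VR2, VR3, VR4 and OC, for all orientations,
together with isotopies of the plane. -/
inductive Welded {C : Type*} : LocalMove C
  | planar {x y : Stack C} (h : Planar x y) : Welded x y
  /-- R1 for a classical crossing, VR1 for a virtual one, curl on the right -/
  | curl_right (k : Kind) (a : Strand C) :
      Welded [⟨[a], .cup a, []⟩, ⟨[], .cross k a a, [a.rev]⟩, ⟨[a], .cap a, []⟩] []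
  /-- R1 for a classical crossing, VR1 for a virtual one, curl on the left -/
  | curl_left (k : Kind) (a : Strand C) :
      Welded [⟨[], .cup a.rev, [a]⟩, ⟨[a.rev], .cross k a a, []⟩, ⟨[], .cap a.rev, [a]⟩] []
  /-- R2 for classical crossings, VR2 for virtual ones -/
  | bigon (k : Kind) (a b : Strand C) :
      Welded [⟨[], .cross k a b, []⟩, ⟨[], .cross k.flip b a, []⟩] []
  /-- R3, VR3, VR4 and OC -/
  | triangle {k₁₂ k₁₃ k₂₃ : Kind} (h : Triangle k₁₂ k₁₃ k₂₃) (a b c : Strand C) :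
      Welded
        [⟨[], .cross k₁₂ a b, [c]⟩, ⟨[b], .cross k₁₃ a c, []⟩, ⟨[], .cross k₂₃ b c, [a]⟩]
        [⟨[a], .cross k₂₃ b c, []⟩, ⟨[], .cross k₁₃ a c, [b]⟩, ⟨[c], .cross k₁₂ a b, []⟩]

/-- `n` consecutive half twists of two vertical strands, all of kind `k`. -/
def twist {C : Type*} (k : Kind) : Strand C → Strand C → ℕ → Stack C
  | _, _, 0 => []
  | a, b, n + 1 => ⟨[], .cross k a b, []⟩ :: twist k b a n

/-- The local move that replaces two vertical strands without crossings by a virtual crossing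
followed by `n` half twists of kind `k`; at the bottom the left strand has direction `d` and the
right strand has direction `e` (`true` is upwards). -/
inductive TwistMove {C : Type*} (n : ℕ) (k : Kind) (d e : Bool) : LocalMove C
  | mk (a b : Strand C) (ha : a.up = d) (hb : b.up = e) :
      TwistMove n k d e [] (⟨[], .cross .virt a b, []⟩ :: twist k b a n)

/-- The `V(n)`-move: both strands have the same direction `d`. -/
def VMove (C : Type*) (n : ℕ) (k : Kind) (d : Bool) : LocalMove C := TwistMove n k d d

/-- The `V̄(n)`-move: the strands are antiparallel, the left one has direction `d`. -/
def VBarMove (C : Type*) (n : ℕ) (k : Kind) (d : Bool) : LocalMove C := TwistMove n k d (!d)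

/-- Every application of `M` is a finite sequence of applications of `N` and of welded Reidemeister
moves, in either direction. -/
def Realizes {C : Type*} (N M : LocalMove C) : Prop :=
  ∀ D D' : Diagram C, Step M D D' →
    Relation.EqvGen (fun E E' => Step N E E' ∨ Step Welded E E') D D'

/-- Two local moves are equivalent if each is realized by a sequence of the other and welded
Reidemeister moves. -/
def EquivalentMoves {C : Type*} (M N : LocalMove C) : Prop := Realizes N M ∧ Realizes M N

end WeldedLink

namespace WeldedLink

variable {C : Type*}

/-! All orientations and signs are treated at once: modulo welded moves, any one of these twist
moves implies every other (`realizes_twistMove`). Write n = 2m + 1. In the presence of the move, n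
half twists equal a virtual crossing for strands of the prescribed directions (`Flat`).

A strand c passes under n half twists by R3. Replacing the twists by a virtual crossing, c passes
under that virtual crossing (`underpass_of_flat`): the forbidden companion of OC, so far only for
the prescribed directions. Call a classical crossing followed by a virtual one an arrow; it acts
invertibly on the tangles above it. VR3 and VR4 turn passing a virtual crossing into commutation of
two arrows that share a strand. OC and the new move each give one case; cancelling the third arrow
in R3 gives the remaining ones.

To reverse a strand, insert a virtual curl (VR1), so that part of it runs backwards. An arrow on the
reversed part slides around the bend and becomes the inverse arrow on the original strand. This
transports first the forbidden move (`Passes.rev`), then, since arrows now commute, the twist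
relation itself: a twist with its virtual crossing is an alternating product of arrows, whose
factors slide around the bend one at a time (`Flat.rev`). Changes of sign come from inverting the
relation (`Flat.flip`). -/

theorem Kind.flip_flip (k : Kind) : k.flip.flip = k := by cases k <;> rfl

@[simp]
theorem Strand.rev_rev (a : Strand C) : a.rev.rev = a := by
  cases a; simp [Strand.rev]

@[simp]
theorem Strand.rev_up (a : Strand C) : a.rev.up = !a.up := rfl

theorem Stack.runs_append {s u : List (Strand C)} {x y : Stack C} :
    Stack.Runs s (x ++ y) u ↔ ∃ t, Stack.Runs s x t ∧ Stack.Runs t y u := by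
  induction x generalizing s with
  | nil => simp [Stack.Runs]
  | cons a x ih =>
    simp only [List.cons_append, Stack.Runs, ih]
    constructor
    · rintro ⟨h, t, h₁, h₂⟩
      exact ⟨t, ⟨h, h₁⟩, h₂⟩
    · rintro ⟨t, ⟨h, h₁⟩, h₂⟩
      exact ⟨h, t, h₁, h₂⟩

theorem Stack.Runs.append {s t u : List (Strand C)} {x y : Stack C} (hx : Stack.Runs s x t)
    (hy : Stack.Runs t y u) : Stack.Runs s (x ++ y) u :=
  Stack.runs_append.2 ⟨t, hx, hy⟩

theorem Stack.Runs.place {s t : List (Strand C)} {w : Stack C} (hw : Stack.Runs s w t)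
    (l r : List (Strand C)) : Stack.Runs (l ++ s ++ r) (Stack.place l w r) (l ++ t ++ r) := by
  induction w generalizing s with
  | nil =>
    have h : s = t := hw
    subst h
    exact rfl
  | cons x w ih =>
    obtain ⟨rfl, h⟩ := hw
    refine ⟨by simp [Layer.bot], ?_⟩
    have := ih h
    simpa [Layer.top, Stack.place] using this

theorem Stack.place_append (l r : List (Strand C)) (x y : Stack C) :
    Stack.place l (x ++ y) r = Stack.place l x r ++ Stack.place l y r :=
  List.map_append

theorem Stack.place_place (l r l' r' : List (Strand C)) (x : Stack C) :
    Stack.place l (Stack.place l' x r') r = Stack.place (l ++ l') x (r' ++ r) := by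
  simp [Stack.place, Function.comp_def]

/-! ### Deformation classes of pictures and operators on them -/

/-- The equivalence relation on diagrams generated by `N` and the welded Reidemeister moves. -/
def Moves (N : LocalMove C) : Diagram C → Diagram C → Prop :=
  Relation.EqvGen fun E E' => Step N E E' ∨ Step Welded E E'

/-- The pictures `x` and `y`, both with strands `s` at the bottom and `t` at the top, can be
exchanged in every diagram by means of `N` and the welded Reidemeister moves. -/
def Deforms (N : LocalMove C) (s t : List (Strand C)) (x y : Stack C) : Prop :=
  ∀ (p q : Stack C) (l r : List (Strand C)), Stack.Runs [] p (l ++ s ++ r) →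
    Stack.Runs (l ++ t ++ r) q [] → ∀ D D' : Diagram C, D.stack = p ++ Stack.place l x r ++ q →
      D'.stack = p ++ Stack.place l y r ++ q → Moves N D D'

namespace Deforms

variable {N : LocalMove C} {s t u : List (Strand C)} {x y z : Stack C}

theorem of_move (h : N x y) : Deforms N s t x y := fun p q l r _ _ _ _ hD hD' =>
  .rel _ _ (.inl ⟨x, y, p, q, l, r, h, hD, hD'⟩)

theorem of_welded (h : Welded x y) : Deforms N s t x y := fun p q l r _ _ _ _ hD hD' =>
  .rel _ _ (.inr ⟨x, y, p, q, l, r, h, hD, hD'⟩)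

theorem refl (x : Stack C) : Deforms N s t x x := by
  rintro p q l r - - ⟨_, _⟩ ⟨_, _⟩ rfl rfl
  exact .refl _

theorem symm (h : Deforms N s t x y) : Deforms N s t y x := fun p q l r hp hq _ _ hD hD' =>
  .symm _ _ (h p q l r hp hq _ _ hD' hD)

theorem trans (hy : Stack.Runs s y t) (h : Deforms N s t x y) (h' : Deforms N s t y z) :
    Deforms N s t x z := fun p q l r hp hq _ _ hD hD' =>
  let E : Diagram C := ⟨p ++ Stack.place l y r ++ q, (hp.append (hy.place l r)).append hq⟩
  .trans _ E _ (h p q l r hp hq _ E hD rfl) (h' p q l r hp hq E _ rfl hD')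

theorem append_left {w : Stack C} (hw : Stack.Runs s w t) (h : Deforms N t u x y) :
    Deforms N s u (w ++ x) (w ++ y) := fun p q l r hp hq _ _ hD hD' =>
  h (p ++ Stack.place l w r) q l r (hp.append (hw.place l r)) hq _ _
    (by simpa [Stack.place_append] using hD) (by simpa [Stack.place_append] using hD')

theorem place_append (h : Deforms N s t x y) (l r : List (Strand C)) {w : Stack C}
    (hw : Stack.Runs (l ++ t ++ r) w u) :
    Deforms N (l ++ s ++ r) u (Stack.place l x r ++ w) (Stack.place l y r ++ w) :=
  fun p q l' r' hp hq _ _ hD hD' =>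
  h p (Stack.place l' w r' ++ q) (l' ++ l) (r ++ r') (by simpa using hp)
    (by simpa using (hw.place l' r').append hq) _ _
    (by simpa [Stack.place_append, Stack.place_place] using hD)
    (by simpa [Stack.place_append, Stack.place_place] using hD')

end Deforms

/-- Pictures with strands `s` at the bottom and `t` at the top, up to deformation. -/
def deformSetoid (N : LocalMove C) (s t : List (Strand C)) :
    Setoid {w : Stack C // Stack.Runs s w t} where
  r x y := Deforms N s t x.1 y.1
  iseqv := ⟨fun x => .refl x.1, fun h => h.symm, fun {_ y _} h h' => h.trans y.2 h'⟩

/-- Deformation classes of pictures with strands `s` at the bottom and `t` at the top. -/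
def Tangle (N : LocalMove C) (s t : List (Strand C)) := Quotient (deformSetoid N s t)

namespace Tangle

variable {N : LocalMove C} {s t u : List (Strand C)}

/-- The class of a picture. -/
def mk (N : LocalMove C) (w : Stack C) (hw : Stack.Runs s w t) : Tangle N s t :=
  Quotient.mk (deformSetoid N s t) ⟨w, hw⟩

theorem ind {p : Tangle N s t → Prop} (h : ∀ w hw, p (mk N w hw)) (x : Tangle N s t) : p x :=
  Quotient.ind (fun w => h w.1 w.2) x

theorem sound {x y : Stack C} {hx : Stack.Runs s x t} {hy : Stack.Runs s y t}
    (h : Deforms N s t x y) : mk N x hx = mk N y hy :=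
  Quotient.sound (s := deformSetoid N s t) h

theorem exact {x y : Stack C} {hx : Stack.Runs s x t} {hy : Stack.Runs s y t}
    (h : mk N x hx = mk N y hy) : Deforms N s t x y :=
  Quotient.exact (s := deformSetoid N s t) h

/-- Put a picture below a tangle. -/
def below (w : Stack C) (hw : Stack.Runs s w t) : Tangle N t u → Tangle N s u :=
  Quotient.map (sa := deformSetoid N t u) (sb := deformSetoid N s u)
    (fun v => ⟨w ++ v.1, hw.append v.2⟩) fun _ _ h => Deforms.append_left hw h

/-- Makes every local move an identity between operators: the outermost operator is the lowest
piece, and the argument `g` stands for everything above. -/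
theorem below_congr {x y : Stack C} (h : Deforms N s t x y) (l r : List (Strand C))
    (hx : Stack.Runs s x t) (hy : Stack.Runs s y t) (g : Tangle N (l ++ t ++ r) u) :
    below (Stack.place l x r) (hx.place l r) g = below (Stack.place l y r) (hy.place l r) g := by
  induction g using ind with
  | h w hw => exact sound (h.place_append l r hw)

/-- Put a crossing below a tangle. -/
def cross (l : List (Strand C)) (k : Kind) (a b : Strand C) (r : List (Strand C))
    (h : Tangle N (l ++ [b, a] ++ r) u) : Tangle N (l ++ [a, b] ++ r) u :=
  below [⟨l, .cross k a b, r⟩] ⟨rfl, rfl⟩ h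

/-- Put a local minimum below a tangle. -/
def cup (l : List (Strand C)) (a b : Strand C) (hab : b = a.rev) (r : List (Strand C))
    (h : Tangle N (l ++ [a, b] ++ r) u) : Tangle N (l ++ r) u :=
  below [⟨l, .cup a, r⟩] ⟨by simp [Layer.bot, Piece.bot], by rw [hab]; rfl⟩ h

/-- Put a local maximum below a tangle. -/
def cap (l : List (Strand C)) (a b : Strand C) (hab : b = a.rev) (r : List (Strand C))
    (h : Tangle N (l ++ r) u) : Tangle N (l ++ [a, b] ++ r) u :=
  below [⟨l, .cap a, r⟩] ⟨by rw [hab]; rfl, by simp [Layer.top, Piece.top, Stack.Runs]⟩ h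

theorem cross_cancel (l : List (Strand C)) (k : Kind) (a b : Strand C) (r : List (Strand C))
    (h : Tangle N (l ++ [a, b] ++ r) u) : cross l k a b r (cross l k.flip b a r h) = h := by
  induction h using ind with
  | h w hw => exact sound (by
      simpa [Stack.place] using
        (Deforms.of_welded (N := N) (s := [a, b]) (t := [a, b]) (.bigon k a b)).place_append l r hw)

/-! ### Welded moves as operator identities -/

variable (r : List (Strand C)) (a b c x y z z' : Strand C) (hz : z' = z.rev)

theorem triangle {k₁₂ k₁₃ k₂₃ : Kind} (H : Triangle k₁₂ k₁₃ k₂₃)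
    (h : Tangle N (c :: b :: a :: r) u) :
    cross [] k₁₂ a b (c :: r) (cross [b] k₁₃ a c r (cross [] k₂₃ b c (a :: r) h)) =
      cross [a] k₂₃ b c r (cross [] k₁₃ a c (b :: r) (cross [c] k₁₂ a b r h)) := by
  induction h using ind with
  | h w hw =>
    exact sound ((Deforms.of_welded (s := [a, b, c]) (t := [c, b, a])
      (.triangle H a b c)).place_append [] r hw)

theorem triangle_shift {k₁₂ k₁₃ k₂₃ : Kind} (H : Triangle k₁₂ k₁₃ k₂₃)
    (h : Tangle N (x :: c :: b :: a :: r) u) :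
    cross [x] k₁₂ a b (c :: r) (cross [x, b] k₁₃ a c r (cross [x] k₂₃ b c (a :: r) h)) =
      cross [x, a] k₂₃ b c r (cross [x] k₁₃ a c (b :: r) (cross [x, c] k₁₂ a b r h)) := by
  induction h using ind with
  | h w hw =>
    exact sound ((Deforms.of_welded (s := [a, b, c]) (t := [c, b, a])
      (.triangle H a b c)).place_append [x] r hw)

theorem cross_cross (k k' : Kind) (d : Strand C) (h : Tangle N (b :: a :: d :: c :: r) u) :
    cross [] k a b (c :: d :: r) (cross [b, a] k' c d r h) =
      cross [a, b] k' c d r (cross [] k a b (d :: c :: r) h) := by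
  induction h using ind with
  | h w hw =>
    exact sound ((Deforms.of_welded (s := [a, b, c, d]) (t := [b, a, d, c])
      (.planar (.exchange (.cross k a b) (.cross k' c d) []))).place_append [] r hw)

theorem cross_cross_shift (k k' : Kind) (d : Strand C)
    (h : Tangle N (b :: a :: x :: d :: c :: r) u) :
    cross [] k a b (x :: c :: d :: r) (cross [b, a, x] k' c d r h) =
      cross [a, b, x] k' c d r (cross [] k a b (x :: d :: c :: r) h) := by
  induction h using ind with
  | h w hw =>
    exact sound ((Deforms.of_welded (s := [a, b, x, c, d]) (t := [b, a, x, d, c])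
      (.planar (.exchange (.cross k a b) (.cross k' c d) [x]))).place_append [] r hw)

theorem cross_cap (k : Kind) (h : Tangle N (b :: a :: r) u) :
    cross [] k a b (z :: z' :: r) (cap [b, a] z z' hz r h) =
      cap [a, b] z z' hz r (cross [] k a b r h) := by
  subst hz
  induction h using ind with
  | h w hw =>
    exact sound ((Deforms.of_welded (s := [a, b, z, z.rev]) (t := [b, a])
      (.planar (.exchange (.cross k a b) (.cap z) []))).place_append [] r hw)

theorem cross_cup (k : Kind) (h : Tangle N (b :: a :: z :: z' :: r) u) :
    cross [] k a b r (cup [b, a] z z' hz r h) =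
      cup [a, b] z z' hz r (cross [] k a b (z :: z' :: r) h) := by
  subst hz
  induction h using ind with
  | h w hw =>
    exact sound ((Deforms.of_welded (s := [a, b]) (t := [b, a, z, z.rev])
      (.planar (.exchange (.cross k a b) (.cup z) []))).place_append [] r hw)

theorem cap_cross (k : Kind) (h : Tangle N (b :: a :: r) u) :
    cap [] z z' hz (a :: b :: r) (cross [] k a b r h) =
      cross [z, z'] k a b r (cap [] z z' hz (b :: a :: r) h) := by
  subst hz
  induction h using ind with
  | h w hw =>
    exact sound ((Deforms.of_welded (s := [z, z.rev, a, b]) (t := [b, a])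
      (.planar (.exchange (.cap z) (.cross k a b) []))).place_append [] r hw)

theorem cap_slide (k : Kind) (h : Tangle N (y :: r) u) :
    cross [z] k y z' r (cap [] z z' hz (y :: r) h) =
      cross [] k.flip z y (z' :: r) (cap [y] z z' hz r h) := by
  subst hz
  induction h using ind with
  | h w hw =>
    exact sound ((Deforms.of_welded (s := [z, y, z.rev]) (t := [y])
      (.planar (.cap_slide k z y))).place_append [] r hw)

theorem cup_slide (k : Kind) (h : Tangle N (z :: y :: z' :: r) u) :
    cup [y] z z' hz r (cross [] k y z (z' :: r) h) =
      cup [] z z' hz (y :: r) (cross [z] k.flip z' y r h) := by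
  subst hz
  induction h using ind with
  | h w hw =>
    exact sound ((Deforms.of_welded (s := [y]) (t := [z, y, z.rev])
      (.planar (.cup_slide k z y))).place_append [] r hw)

theorem curl (h : Tangle N (x :: z' :: r) u) :
    cup [x] z z' hz (z' :: r) (cross [x, z] .virt z' z' r (cap [x] z z' hz (z' :: r) h)) = h := by
  obtain rfl : z = z'.rev := by rw [hz, Strand.rev_rev]
  induction h using ind with
  | h w hw =>
    exact sound ((Deforms.of_welded (s := [z']) (t := [z'])
      (.curl_left .virt z')).place_append [x] r hw)

theorem over_under (l : List (Strand C)) (h : Tangle N (l ++ [a, b] ++ r) u) :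
    cross l .over a b r (cross l .under b a r h) = h :=
  cross_cancel l .over a b r h

theorem under_over (l : List (Strand C)) (h : Tangle N (l ++ [a, b] ++ r) u) :
    cross l .under a b r (cross l .over b a r h) = h :=
  cross_cancel l .under a b r h

theorem virt_virt (l : List (Strand C)) (h : Tangle N (l ++ [a, b] ++ r) u) :
    cross l .virt a b r (cross l .virt b a r h) = h :=
  cross_cancel l .virt a b r h

/-! ### Twists and passing a virtual crossing -/

/-- A full twist of two strands below a tangle. -/
def fullTwist (k : Kind) (l : List (Strand C)) (h : Tangle N (l ++ [a, b] ++ r) u) :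
    Tangle N (l ++ [a, b] ++ r) u :=
  cross l k a b r (cross l k b a r h)

/-- Next to the strands `l`, the `2 * m + 1` half twists of kind `k` of `a` and `b` can be replaced by
a virtual crossing. -/
def Flat (N : LocalMove C) (m : ℕ) (k : Kind) (l : List (Strand C)) (a b : Strand C) : Prop :=
  ∀ (r u : List (Strand C)) (h : Tangle N (l ++ [b, a] ++ r) u),
    cross l k a b r ((fullTwist r b a k l)^[m] h) = cross l .virt a b r h

/-- A strand with crossings of kinds `k` and `k'` with `a` and `b` can be moved across the virtual
crossing of these. -/
def Passes (N : LocalMove C) (k k' : Kind) (a c b : Strand C) : Prop :=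
  ∀ (r u : List (Strand C)) (h : Tangle N (b :: c :: a :: r) u),
    cross [] k a c (b :: r) (cross [c] .virt a b r (cross [] k' c b (a :: r) h)) =
      cross [a] k' c b r (cross [] .virt a b (c :: r) (cross [b] k a c r h))

/-- The strand `c` lying under `a` and `b` passes the virtual crossing of these. -/
theorem underpass_of_flat {m : ℕ} {a b : Strand C} (hT : Flat N m .over [] a b)
    (hT' : Flat N m .over [c] a b) (h : Tangle N (c :: b :: a :: r) u) :
    cross [] .virt a b (c :: r) (cross [b] .over a c r (cross [] .over b c (a :: r) h)) =
      cross [a] .over b c r (cross [] .over a c (b :: r) (cross [c] .virt a b r h)) := by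
  have R (a b : Strand C) (h : Tangle N (c :: b :: a :: r) u) :
      cross [] .over a b (c :: r) (cross [b] .over a c r (cross [] .over b c (a :: r) h)) =
      cross [a] .over b c r (cross [] .over a c (b :: r) (cross [c] .over a b r h)) :=
    triangle r a b c (.r3 _ _ _ (by simp) (by simp) (by simp) (by simp)) h
  -- Moving c past two half twists restores the order of a and b, so this step can be iterated; one
  -- more R3 handles the odd half twist.
  have key : Function.Semiconj
      (fun h : Tangle N (c :: b :: a :: r) u =>
        (cross [b] .over a c r (cross [] .over b c (a :: r) h) : Tangle N (b :: a :: c :: r) u))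
      (fullTwist r b a .over [c]) (fullTwist (c :: r) b a .over []) := fun h => by
    simp only [fullTwist]
    erw [R a b, R b a]
  have := (key.iterate_right m) h
  rw [← hT', ← hT]
  erw [← this, R]

theorem passes_over_under_of_flat {m : ℕ} {a b : Strand C} (hT : Flat N m .over [] a b)
    (hT' : Flat N m .over [c] a b) : Passes N .over .under a c b := fun r u h => by
  have e := underpass_of_flat r c hT hT' (cross [] .under c b (a :: r) h)
  erw [over_under] at e
  erw [e, under_over]

theorem Passes.symm {a b c : Strand C} (h : Passes N .over .under a c b) :
    Passes N .over .under b c a := fun r u g => by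
  have e := h r u
    (cross [] .over b c (a :: r) (cross [c] .virt b a r (cross [] .under c a (b :: r) g)))
  erw [under_over, virt_virt, over_under] at e
  conv_rhs => rw [e]
  erw [over_under, virt_virt, under_over]

theorem passes_under_over : Passes N .under .over a c b := fun r _ h =>
  triangle r a c b .oc_2 h

/-! ### Commutation of arrows -/

/-- A crossing followed by a virtual crossing, as a permutation of the tangles that can be put above
them. -/
def arrow (N : LocalMove C) (u : List (Strand C)) (l : List (Strand C)) (k : Kind) (a b : Strand C)
    (r : List (Strand C)) : Equiv.Perm (Tangle N (l ++ [a, b] ++ r) u) where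
  toFun h := cross l k a b r (cross l .virt b a r h)
  invFun h := cross l .virt a b r (cross l k.flip b a r h)
  left_inv h := by
    have := cross_cancel l k.flip b a r (cross l .virt b a r h)
    rw [k.flip_flip] at this
    simp only [this, virt_virt]
  right_inv h := by simp only [virt_virt, cross_cancel]

theorem arrow_commute_of_passes {k k' : Kind} (hk : k ≠ .virt) (hk' : k' ≠ .virt) {a b c : Strand C}
    (H : Passes N k k' a c b) : Commute (arrow N u [] k a c (b :: r)) (arrow N u [a] k' c b r) := by
  ext h
  have e₁ := triangle (N := N) r c a b (.vr4_13 _ hk')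
    (cross [] .virt b a (c :: r) (cross [a] .virt b c r h))
  have e₂ := triangle r a b c (.vr4_13 _ hk)
    (cross [c] .virt b a r (cross [] .virt c a (b :: r) h))
  have e₃ := triangle r b c a .vr3 h
  erw [virt_virt] at e₁ e₂
  change cross [] k a c (b :: r) (cross [] .virt c a (b :: r)
    (cross [a] k' c b r (cross [a] .virt b c r h))) =
    cross [a] k' c b r (cross [a] .virt b c r (cross [] k a c (b :: r)
      (cross [] .virt c a (b :: r) h)))
  erw [e₁, H, ← e₃, e₂]

/-- R3 with a over c over b says that the arrows ac, ab, cb have the same product in both orders.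
The arrow ab commutes with cb by the hypothesis, b being under both, and with ac by OC, a being over
both. Cancelling ab leaves the commutation of ac and cb. -/
theorem passes_over_over {a b c : Strand C} (h : Passes N .over .under c b a) :
    Passes N .over .over a c b := fun r u g => by
  have e₁ := DFunLike.congr_fun (arrow_commute_of_passes (u := u) r (by simp) (by simp) h).eq
    (cross [] .virt c b (a :: r) g)
  have e₂ := DFunLike.congr_fun (arrow_commute_of_passes (N := N) (u := u) r (by simp) (by simp)
    (passes_under_over b c a)).eq (cross [b] .virt a c r g)
  have e₃ := triangle r b c a (.vr4_13 .under (by simp))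
    (cross [a] .virt c b r (cross [] .virt a b (c :: r) (cross [b] .virt a c r g)))
  have e₄ := triangle r a c b .vr3 g
  have e₅ := triangle r a c b (.r3 .over .over .over (by simp) (by simp) (by simp) (by simp))
    (cross [] .virt b c (a :: r) (cross [c] .under b a r (cross [c] .virt a b r
      (cross [] .virt c b (a :: r) g))))
  change cross [] .over c b (a :: r) (cross [] .virt b c (a :: r)
    (cross [c] .under b a r (cross [c] .virt a b r (cross [] .virt c b (a :: r) g)))) =
    cross [c] .under b a r (cross [c] .virt a b r (cross [] .over c b (a :: r)
      (cross [] .virt b c (a :: r) (cross [] .virt c b (a :: r) g)))) at e₁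
  change cross [] .under b a (c :: r) (cross [] .virt a b (c :: r)
    (cross [b] .over a c r (cross [b] .virt c a r (cross [b] .virt a c r g)))) =
    cross [b] .over a c r (cross [b] .virt c a r (cross [] .under b a (c :: r)
      (cross [] .virt a b (c :: r) (cross [b] .virt a c r g)))) at e₂
  erw [virt_virt] at e₁ e₂ e₃
  erw [← e₄, virt_virt] at e₃
  erw [e₁, over_under, e₃, ← e₂, over_under] at e₅
  exact e₅

theorem passes_under_under {a b c : Strand C} (h : Passes N .over .over b c a) :
    Passes N .under .under a c b := fun r u g => by
  have e := h r u
    (cross [] .under a c (b :: r) (cross [c] .virt a b r (cross [] .under c b (a :: r) g)))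
  erw [over_under, virt_virt, over_under] at e
  conv_rhs => rw [e]
  erw [under_over, virt_virt, under_over]

theorem arrow_commute (H : ∀ a c b, Passes N .over .under a c b) {k k' : Kind} (hk : k ≠ .virt)
    (hk' : k' ≠ .virt) : Commute (arrow N u [] k a c (b :: r)) (arrow N u [a] k' c b r) := by
  refine arrow_commute_of_passes r hk hk' ?_
  cases k <;> cases k' <;> first | contradiction | skip
  · exact passes_over_over (H c b a)
  · exact H a c b
  · exact passes_under_over a b c
  · exact passes_under_under (passes_over_over (H c a b))

/-- Converse of `arrow_commute_of_passes`; it is needed because reversal of a strand is carried out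
on arrows. -/
theorem passes_of_arrow_commute {k k' : Kind} (hk : k ≠ .virt) (hk' : k' ≠ .virt)
    {a b c : Strand C} (H : ∀ r u, Commute (arrow N u [] k a c (b :: r)) (arrow N u [a] k' c b r)) :
    Passes N k k' a c b := fun r u g => by
  have e₁ := triangle (N := N) r c a b (.vr4_13 _ hk') (cross [b] .virt a c r g)
  have e₂ := triangle r a b c (.vr4_13 _ hk) (cross [c] .virt b a r (cross [] .virt c a (b :: r)
    (cross [a] .virt c b r (cross [] .virt a b (c :: r) (cross [b] .virt a c r g)))))
  have e₃ := triangle r b c a .vr3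
    (cross [a] .virt c b r (cross [] .virt a b (c :: r) (cross [b] .virt a c r g)))
  have e₄ := DFunLike.congr_fun (H r u).eq
    (cross [a] .virt c b r (cross [] .virt a b (c :: r) (cross [b] .virt a c r g)))
  change cross [] k a c (b :: r) (cross [] .virt c a (b :: r)
    (cross [a] k' c b r (cross [a] .virt b c r (cross [a] .virt c b r
      (cross [] .virt a b (c :: r) (cross [b] .virt a c r g)))))) =
    cross [a] k' c b r (cross [a] .virt b c r (cross [] k a c (b :: r)
      (cross [] .virt c a (b :: r) (cross [a] .virt c b r
      (cross [] .virt a b (c :: r) (cross [b] .virt a c r g)))))) at e₄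
  erw [virt_virt, virt_virt, virt_virt] at e₃
  erw [e₃, virt_virt] at e₂
  erw [virt_virt] at e₁
  erw [virt_virt, e₁, ← e₂] at e₄
  exact e₄

/-! ### Arrows around bends, and reversal of a strand -/

/-- A virtual crossing below tangles, as a bijection. -/
def virtEquiv (N : LocalMove C) (u : List (Strand C)) (l : List (Strand C)) (a b : Strand C)
    (r : List (Strand C)) : Tangle N (l ++ [b, a] ++ r) u ≃ Tangle N (l ++ [a, b] ++ r) u where
  toFun := cross l .virt a b r
  invFun := cross l .virt b a r
  left_inv := virt_virt r b a l
  right_inv := virt_virt r a b l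

/-- The arrow between `y` and `z'` next to a strand `z` between them. -/
def jumpArrow (N : LocalMove C) (u : List (Strand C)) (k : Kind) (y z z' : Strand C)
    (r : List (Strand C)) : Equiv.Perm (Tangle N (y :: z :: z' :: r) u) :=
  (virtEquiv N u [] y z (z' :: r)).permCongrHom (arrow N u [z] k y z' r)

theorem arrow_eq_permCongrHom (k : Kind) : arrow N u [] k y z r =
    (virtEquiv N u [] y z r).permCongrHom (arrow N u [] k.flip z y r)⁻¹ := by
  ext h
  change cross [] k y z r (cross [] .virt z y r h) = cross [] .virt y z r (cross [] .virt z y r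
    (cross [] k.flip.flip y z r (cross [] .virt z y r h)))
  rw [k.flip_flip]
  erw [virt_virt]

theorem flip_ne_virt {k : Kind} (hk : k ≠ .virt) : k.flip ≠ .virt := by
  cases k <;> simp_all [Kind.flip]

/-- Conjugating by the virtual crossing of `y` and `z` puts the shared strand `y` in the middle,
where `arrow_commute` applies. -/
theorem jumpArrow_commute (H : ∀ a c b, Passes N .over .under a c b) {k k' : Kind} (hk : k ≠ .virt)
    (hk' : k' ≠ .virt) :
    Commute (jumpArrow N u k y z z' r) (arrow N u [] k' y z (z' :: r)) := by
  rw [arrow_eq_permCongrHom, jumpArrow]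
  exact (((arrow_commute r z z' y H (flip_ne_virt hk') hk).inv_left).symm).map
    ((virtEquiv N u [] y z (z' :: r)).permCongrHom)

/-- Both crossings of the arrow slide around the minimum to its other leg. This changes their kind
and reverses the direction of that leg, hence the inverse. -/
theorem cup_arrow (k : Kind) (h : Tangle N (y :: z :: z' :: r) u) :
    cup [y] z z' hz r (arrow N u [] k y z (z' :: r) h) =
      cup [y] z z' hz r ((jumpArrow N u k y z z' r)⁻¹ h) := by
  change cup [y] z z' hz r (cross [] k y z (z' :: r) (cross [] .virt z y (z' :: r) h)) =
    cup [y] z z' hz r (cross [] .virt y z (z' :: r) (cross [z] .virt y z' r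
      (cross [z] k.flip z' y r (cross [] .virt z y (z' :: r) h))))
  erw [cup_slide, cup_slide, virt_virt]

/-- The strand `z'` passes the next strand virtually and meets `z` in a local maximum. -/
def turn (hz : z' = z.rev) (h : Tangle N (y :: z' :: r) u) :
    Tangle N (y :: z :: z' :: z' :: r) u :=
  cross [y, z] .virt z' z' r (cap [y] z z' hz (z' :: r) h)

theorem cup_turn (h : Tangle N (y :: z' :: r) u) :
    cup [y] z z' hz (z' :: r) (turn r y z z' hz h) = h :=
  curl r y z z' hz h

/-- The arrow sits on the leg that continues upwards, so it leaves the curl; only virtual crossings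
have to pass it, by VR3 and VR4. -/
theorem jumpArrow_inv_turn {k : Kind} (hk : k ≠ .virt) (h : Tangle N (y :: z' :: r) u) :
    (jumpArrow N u k y z z' (z' :: r))⁻¹ (turn r y z z' hz h) =
      turn r y z z' hz ((arrow N u [] k y z' r)⁻¹ h) := by
  change cross [] .virt y z (z' :: z' :: r) (cross [z] .virt y z' (z' :: r)
    (cross [z] k.flip z' y (z' :: r) (cross [] .virt z y (z' :: z' :: r)
      (cross [y, z] .virt z' z' r (cap [y] z z' hz (z' :: r) h))))) =
    cross [y, z] .virt z' z' r (cap [y] z z' hz (z' :: r) (cross [] .virt y z' r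
      (cross [] k.flip z' y r h)))
  have e₁ := cap_slide (z' :: r) y z z' hz .virt h
  have e₂ := triangle_shift (N := N) (u := u) r z' y z' z (.vr4_12 k.flip (flip_ne_virt hk))
    (cap [] z z' hz (y :: z' :: r) h)
  have e₃ := triangle_shift (N := N) (u := u) r y z' z' z .vr3
    (cross [z, z'] k.flip z' y r (cap [] z z' hz (y :: z' :: r) h))
  have e₄ := cap_slide (z' :: r) y z z' hz .virt (cross [] .virt y z' r (cross [] k.flip z' y r h))
  erw [cross_cross, ← e₁, e₂, e₃, ← cap_cross, ← cap_cross, e₄, cross_cross, virt_virt]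

theorem jumpArrow_turn {k : Kind} (hk : k ≠ .virt) (h : Tangle N (y :: z' :: r) u) :
    jumpArrow N u k y z z' (z' :: r) (turn r y z z' hz h) =
      turn r y z z' hz (arrow N u [] k y z' r h) := by
  rw [← Equiv.Perm.eq_inv_iff_eq, jumpArrow_inv_turn r y z z' hz hk]
  exact congrArg _ (Equiv.symm_apply_apply _ _).symm

theorem cup_arrow_turn {k : Kind} (hk : k ≠ .virt) (h : Tangle N (y :: z' :: r) u) :
    cup [y] z z' hz (z' :: r) (arrow N u [] k y z (z' :: z' :: r) (turn r y z z' hz h)) =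
      (arrow N u [] k y z' r)⁻¹ h := by
  rw [cup_arrow, jumpArrow_inv_turn r y z z' hz hk, cup_turn]

theorem cup_arrow_turn_shift {k : Kind} (hk : k ≠ .virt) (h : Tangle N (x :: y :: z' :: r) u) :
    cup [x, y] z z' hz (z' :: r) (arrow N u [x] k y z (z' :: z' :: r)
      (cross [x, y, z] .virt z' z' r (cap [x, y] z z' hz (z' :: r) h))) =
      (arrow N u [x] k y z' r)⁻¹ h := by
  subst hz
  -- Evaluated at the trivial tangle, the operator identity becomes a deformation of pictures, which
  -- may be placed to the right of `x`.
  have e := exact (cup_arrow_turn (N := N) [] y z z.rev rfl hk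
    (mk N (t := [y, z.rev]) [] rfl))
  induction h using ind with
  | h w hw => exact sound (e.place_append [x] r hw)

theorem Passes.rev {a b c : Strand C} (H : Passes N .over .under a c b) :
    Passes N .over .under a c b.rev := by
  refine passes_of_arrow_commute (by simp) (by simp) fun r u => ?_
  rw [← Commute.inv_right_iff]
  ext h
  have hb : b.rev = b.rev := rfl
  have hH := fun h => DFunLike.congr_fun (arrow_commute_of_passes (u := u) (b.rev :: b.rev :: r)
    (by simp) (by simp) H).eq h
  simp only [Equiv.Perm.mul_apply] at hH ⊢
  -- The inverse arrow on `b.rev` is an arrow on `b` inside a curl. The arrow of `a` and `c`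
  -- commutes with it by `H` and is far from the minimum and the turn.
  rw [← cup_arrow_turn_shift r a c b b.rev hb (by simp),
    ← cup_arrow_turn_shift r a c b b.rev hb (by simp)]
  have e₁ (h : Tangle N (a :: c :: b :: b.rev :: b.rev :: r) u) :
      arrow N u [] .over a c (b.rev :: r) (cup [a, c] b b.rev hb (b.rev :: r) h) =
        cup [a, c] b b.rev hb (b.rev :: r)
          (arrow N u [] .over a c (b :: b.rev :: b.rev :: r) h) := by
    change cross [] .over a c (b.rev :: r) (cross [] .virt c a (b.rev :: r)
      (cup [a, c] b b.rev hb (b.rev :: r) h)) = cup [a, c] b b.rev hb (b.rev :: r)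
        (cross [] .over a c (b :: b.rev :: b.rev :: r)
          (cross [] .virt c a (b :: b.rev :: b.rev :: r) h))
    erw [cross_cup, cross_cup]
  have e₂ (h : Tangle N (a :: c :: b.rev :: r) u) :
      arrow N u [] .over a c (b :: b.rev :: b.rev :: r) (cross [a, c, b] .virt b.rev b.rev r
        (cap [a, c] b b.rev hb (b.rev :: r) h)) =
      cross [a, c, b] .virt b.rev b.rev r
        (cap [a, c] b b.rev hb (b.rev :: r) (arrow N u [] .over a c (b.rev :: r) h)) := by
    change cross [] .over a c (b :: b.rev :: b.rev :: r)
      (cross [] .virt c a (b :: b.rev :: b.rev :: r) (cross [a, c, b] .virt b.rev b.rev r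
        (cap [a, c] b b.rev hb (b.rev :: r) h))) =
      cross [a, c, b] .virt b.rev b.rev r (cap [a, c] b b.rev hb (b.rev :: r)
        (cross [] .over a c (b.rev :: r) (cross [] .virt c a (b.rev :: r) h)))
    erw [cross_cross_shift, cross_cross_shift, cross_cap, cross_cap]
  erw [e₁, hH, e₂]

/-! ### The twist relation under change of sign and direction -/

theorem semiconj_fullTwist (k : Kind) (l : List (Strand C)) :
    Function.Semiconj (fun h : Tangle N (l ++ [b, a] ++ r) u => cross l k a b r h)
      (fullTwist r b a k l) (fullTwist r a b k l) := fun _ => rfl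

theorem fullTwist_leftInverse (k : Kind) (l : List (Strand C)) :
    Function.LeftInverse (fullTwist (N := N) (u := u) r a b k l) (fullTwist r a b k.flip l) :=
  fun h => by
    have e₁ := cross_cancel l k b a r (cross l k.flip b a r h)
    have e₂ := cross_cancel l k a b r h
    simp only [fullTwist, e₁, e₂]

theorem Flat.flip {m : ℕ} {k : Kind} {l : List (Strand C)} {a b : Strand C}
    (H : Flat N m k l a b) : Flat N m k.flip l b a := fun r u h => by
  have e := H r u (cross l k.flip b a r ((fullTwist r a b k.flip l)^[m] h))
  have e₁ := ((semiconj_fullTwist (N := N) (u := u) r a b k l).iterate_right m)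
    (cross l k.flip b a r ((fullTwist r a b k.flip l)^[m] h))
  rw [e₁, cross_cancel, (fullTwist_leftInverse r a b k l).iterate m h] at e
  conv_rhs => rw [e]
  rw [virt_virt]

/-- A full twist is the arrow of kind `k` times the inverse of the arrow of the flipped kind,
because the inner virtual crossings cancel. -/
theorem flat_iff {m : ℕ} {k : Kind} {a b : Strand C} : Flat N m k [] a b ↔
    ∀ r u, (arrow N u [] k a b r * (arrow N u [] k.flip a b r)⁻¹) ^ m * arrow N u [] k a b r = 1 := by
  have key (r u) (h : Tangle N ([a, b] ++ r) u) :
      ((arrow N u [] k a b r * (arrow N u [] k.flip a b r)⁻¹) ^ m * arrow N u [] k a b r) h =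
      cross [] k a b r ((fullTwist r b a k [])^[m] (cross [] .virt b a r h)) := by
    have e₁ : ⇑(arrow N u [] k a b r * (arrow N u [] k.flip a b r)⁻¹) =
        fullTwist r a b k [] := by
      ext g
      change cross [] k a b r (cross [] .virt b a r (cross [] .virt a b r
        (cross [] k.flip.flip b a r g))) = _
      rw [virt_virt, Kind.flip_flip]
      rfl
    rw [Equiv.Perm.mul_apply, Equiv.Perm.coe_pow, e₁]
    exact (((semiconj_fullTwist r a b k []).iterate_right m) (cross [] .virt b a r h)).symm
  constructor
  · intro H r u
    ext h
    rw [key, H, virt_virt]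
    rfl
  · intro H r u h
    have := key r u (cross [] .virt a b r h)
    rw [H, virt_virt] at this
    exact this.symm

/-- Slide the factors of an alternating product around a bend. -/
theorem slide_alternating {α β : Type*} {O : α → β} {K : β → α} {A B A' B' : Equiv.Perm α}
    {a b : Equiv.Perm β} (hOK : ∀ h, O (K h) = h) (hA : ∀ g, O (A g) = O (A' g))
    (hB : ∀ g, O (B g) = O (B' g)) (ha : ∀ h, A' (K h) = K (a h)) (hb : ∀ h, B' (K h) = K (b h))
    (hAA : Commute A' A) (hAB : Commute A' B) (hBA : Commute B' A) (hBB : Commute B' B)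
    (m : ℕ) (h : β) : O (((A * B) ^ m * A) (K h)) = (a * (b * a) ^ m) h := by
  induction m generalizing h with
  | zero => simp [hA, ha, hOK]
  | succ m ih =>
    have e₁ : A' * (B * ((A * B) ^ m * A)) = B * ((A * B) ^ m * A) * A' :=
      (hAB.mul_right (((hAA.mul_right hAB).pow_right m).mul_right hAA)).eq
    have e₂ : B' * ((A * B) ^ m * A) = (A * B) ^ m * A * B' :=
      (((hBA.mul_right hBB).pow_right m).mul_right hBA).eq
    calc O (((A * B) ^ (m + 1) * A) (K h)) = O ((A' * (B * ((A * B) ^ m * A))) (K h)) := by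
          rw [pow_succ', mul_assoc, mul_assoc, Equiv.Perm.mul_apply, hA]
          rfl
      _ = O ((B' * ((A * B) ^ m * A)) (K (a h))) := by
          rw [e₁, Equiv.Perm.mul_apply, ha, Equiv.Perm.mul_apply, hB]
          rfl
      _ = (a * (b * a) ^ m) (b (a h)) := by
          rw [e₂, Equiv.Perm.mul_apply, hb, ih]
      _ = (a * (b * a) ^ (m + 1)) h := by
          rw [pow_succ]
          rfl

theorem inv_mul_pow_mul {G : Type*} [Group G] (A B : G) (m : ℕ) :
    (A⁻¹ * (B * A⁻¹) ^ m)⁻¹ = (A * B⁻¹) ^ m * A := by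
  rw [mul_inv_rev, ← inv_pow, mul_inv_rev, inv_inv]

theorem Flat.rev (H : ∀ a c b, Passes N .over .under a c b) {m : ℕ} {k : Kind} (hk : k ≠ .virt)
    {y z : Strand C} (hT : Flat N m k [] y z) : Flat N m k [] y z.rev := by
  obtain ⟨z', hz⟩ : ∃ z', z' = z.rev := ⟨_, rfl⟩
  rw [← hz, flat_iff]
  rw [flat_iff] at hT
  intro r u
  have hk' := flip_ne_virt hk
  -- Sliding around the bend inverts each factor and reverses the order, so it is the inverse of the
  -- goal that appears.
  rw [← inv_mul_pow_mul, inv_eq_one]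
  ext h
  have hc {k k' : Kind} (hk : k ≠ .virt) (hk' : k' ≠ .virt) :=
    jumpArrow_commute (u := u) (z' :: r) y z z' H hk hk'
  rw [← slide_alternating (O := cup [y] z z' hz (z' :: r)) (K := turn r y z z' hz)
    (A := arrow N u [] k y z (z' :: z' :: r)) (B := (arrow N u [] k.flip y z (z' :: z' :: r))⁻¹)
    (A' := (jumpArrow N u k y z z' (z' :: r))⁻¹) (B' := jumpArrow N u k.flip y z z' (z' :: r))
    (cup_turn r y z z' hz) (cup_arrow _ y z z' hz k) ?_ (jumpArrow_inv_turn r y z z' hz hk)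
    (jumpArrow_turn r y z z' hz hk') (hc hk hk).inv_left (hc hk hk').inv_inv (hc hk' hk)
    (hc hk' hk').inv_right]
  · erw [hT]
    exact cup_turn r y z z' hz h
  · intro g
    -- For the inverse factor, apply `cup_arrow` to B⁻¹Jg, with J the jump arrow and B the arrow;
    -- J⁻¹B⁻¹J = B⁻¹ by commutation.
    have e := cup_arrow (N := N) (u := u) (z' :: r) y z z' hz k.flip
      ((arrow N u [] k.flip y z (z' :: z' :: r))⁻¹ (jumpArrow N u k.flip y z z' (z' :: r) g))
    rw [← Equiv.Perm.mul_apply, mul_inv_cancel, Equiv.Perm.one_apply,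
      ← Equiv.Perm.mul_apply _ _ g, ← (hc hk' hk').inv_right.eq, ← Equiv.Perm.mul_apply,
      inv_mul_cancel_left] at e
    exact e.symm

theorem forall_strands {p : Strand C → Strand C → Prop} {d e : Bool}
    (h : ∀ a b : Strand C, a.up = d → b.up = e → p a b) (hl : ∀ a b, p a b → p a.rev b)
    (hr : ∀ a b, p a b → p a b.rev) (a b : Strand C) : p a b := by
  have h₁ (a b : Strand C) (ha : a.up = d) : p a b := by
    by_cases hb : b.up = e
    · exact h a b ha hb
    · simpa using hr a b.rev (h a b.rev ha (by simpa [← Bool.not_eq] using hb))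
  by_cases ha : a.up = d
  · exact h₁ a b ha
  · simpa using hl a.rev b (h₁ a.rev b (by simpa [← Bool.not_eq] using ha))

theorem flat_of_flat {m : ℕ} {d e : Bool}
    (hT : ∀ (l : List (Strand C)) (a b : Strand C), a.up = d → b.up = e → Flat N m .over l a b)
    (a b : Strand C) : Flat N m .over [] a b := by
  have H (a c b : Strand C) : Passes N .over .under a c b :=
    forall_strands (p := fun a b => Passes N .over .under a c b) (d := d) (e := e)
      (fun a b ha hb => passes_over_under_of_flat c (hT [] a b ha hb) (hT [c] a b ha hb))
      (fun a b h => h.symm.rev.symm) (fun a b h => h.rev) a b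
  exact forall_strands (p := fun a b => Flat N m .over [] a b) (fun a b => hT [] a b)
    (fun a b h => (h.flip.rev H (by simp [Kind.flip])).flip)
    (fun a b h => h.rev H (by simp)) a b

end Tangle

/-! ### From operator identities back to moves on diagrams -/

theorem runs_twist (k : Kind) (a b : Strand C) (m : ℕ) :
    Stack.Runs [a, b] (twist k a b (2 * m + 1)) [b, a] := by
  induction m with
  | zero => exact ⟨rfl, rfl⟩
  | succ m ih => exact ⟨rfl, rfl, ih⟩

theorem Tangle.below_cons {N : LocalMove C} {t u : List (Strand C)} (l : List (Strand C)) (k : Kind)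
    (a b : Strand C) (r : List (Strand C)) {v w : Stack C} (hv : v = ⟨l, .cross k a b, r⟩ :: w)
    (h : Stack.Runs (l ++ [a, b] ++ r) v t) (hw : Stack.Runs (l ++ [b, a] ++ r) w t)
    (g : Tangle N t u) : below v h g = cross l k a b r (below w hw g) := by
  subst hv
  induction g using ind with
  | h w' hw' => rfl

theorem Tangle.below_twist {N : LocalMove C} {u : List (Strand C)} (k : Kind) (a b : Strand C)
    (m : ℕ) (l r : List (Strand C)) (h : Tangle N (l ++ [b, a] ++ r) u) :
    below _ ((runs_twist k a b m).place l r) h =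
      cross l k a b r ((fullTwist r b a k l)^[m] h) := by
  induction m with
  | zero =>
    rw [below_cons l k a b r (w := []) (by simp [Stack.place, twist]) _ (by rfl)]
    induction h using ind with
    | h w hw => rfl
  | succ m ih =>
    rw [Function.iterate_succ_apply']
    change _ = cross l k a b r (cross l k b a r (cross l k a b r _))
    have hw := (runs_twist k a b m).place l r
    rw [← ih, below_cons (w := ⟨l, .cross k b a, r⟩ :: Stack.place l (twist k a b (2 * m + 1)) r)
      l k a b r (by simp [Stack.place, twist, mul_add]) _ ⟨rfl, hw⟩]
    exact congrArg _ (below_cons l k b a r rfl _ hw h)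

theorem Stack.Runs.unique {s t t' : List (Strand C)} {w : Stack C} (h : Stack.Runs s w t)
    (h' : Stack.Runs s w t') : t = t' := by
  induction w generalizing s with
  | nil => exact h.symm.trans h'
  | cons x w ih => exact ih h.2 h'.2

theorem Stack.place_nil (w : Stack C) : Stack.place [] w [] = w := by
  simp [Stack.place]

theorem Tangle.below_virt_twist {N : LocalMove C} {u : List (Strand C)} (k : Kind) (a b : Strand C)
    (m : ℕ) (l r : List (Strand C)) (h : Tangle N (l ++ [a, b] ++ r) u) :
    below _ (Stack.Runs.place (s := [a, b]) (t := [a, b])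
      (w := ⟨[], .cross .virt a b, []⟩ :: twist k b a (2 * m + 1))
      ⟨rfl, runs_twist k b a m⟩ l r) h =
      cross l .virt a b r (cross l k b a r ((fullTwist r a b k l)^[m] h)) := by
  rw [← below_twist]
  exact below_cons l .virt a b r (by simp [Stack.place]) _ _ h

theorem flat_of_twistMove (m : ℕ) (k : Kind) {d e : Bool} (l : List (Strand C)) {a b : Strand C}
    (ha : a.up = d) (hb : b.up = e) :
    Tangle.Flat (TwistMove (2 * m + 1) k d e) m k l b a := fun r u h => by
  have := Tangle.below_congr (N := TwistMove (2 * m + 1) k d e) (s := [a, b]) (t := [a, b])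
    (.of_move (.mk a b ha hb)) l r rfl ⟨rfl, runs_twist k b a m⟩ h
  rw [Tangle.below_virt_twist] at this
  rw [← Tangle.virt_virt r b a l (Tangle.cross l k b a r _), ← this]
  induction h using Tangle.ind with
  | h w hw => rfl

theorem deforms_of_flat {N : LocalMove C} {m : ℕ} {k : Kind} {a b : Strand C}
    (H : Tangle.Flat N m k [] b a) :
    Deforms N [a, b] [a, b] [] (⟨[], .cross .virt a b, []⟩ :: twist k b a (2 * m + 1)) := by
  have := Tangle.below_virt_twist (N := N) k a b m [] [] (Tangle.mk N (t := [a, b]) [] rfl)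
  rw [H, Tangle.virt_virt] at this
  simpa [Stack.place_nil] using Tangle.exact (N := N) (x := []) (y := Stack.place []
    (⟨[], .cross .virt a b, []⟩ :: twist k b a (2 * m + 1)) [] ++ []) this.symm

theorem realizes_twistMove {n : ℕ} (hn : Odd n) {k k' : Kind} (hk : k ≠ .virt) (hk' : k' ≠ .virt)
    (d e d' e' : Bool) : Realizes (TwistMove (C := C) n k d e) (TwistMove n k' d' e') := by
  obtain ⟨m, rfl⟩ := hn
  have hT (a b : Strand C) : Tangle.Flat (TwistMove (2 * m + 1) k d e) m .over [] a b := by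
    rcases k with _ | _ | _
    · exact Tangle.flat_of_flat (fun l a b ha hb => flat_of_twistMove m .over l hb ha) a b
    · exact Tangle.flat_of_flat (fun l a b ha hb => (flat_of_twistMove m .under l ha hb).flip) a b
    · contradiction
  have hT' (a b : Strand C) : Tangle.Flat (TwistMove (2 * m + 1) k d e) m k' [] a b := by
    rcases k' with _ | _ | _
    · exact hT a b
    · exact (hT b a).flip
    · contradiction
  rintro D D' ⟨_, _, p, q, l, r, ⟨a, b, -, -⟩, hD, hD'⟩
  -- The boundary strands are read off from `D'`: its virtual crossing determines them, whereas the
  -- empty picture in `D` does not.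
  have hc := D'.closed
  rw [hD', Stack.runs_append] at hc
  obtain ⟨t₂, hc, hq⟩ := hc
  rw [Stack.runs_append] at hc
  obtain ⟨t₁, hp, hy⟩ := hc
  have h₁ : t₁ = l ++ [a, b] ++ r := by
    have := hy.1
    simpa [Layer.bot, Piece.bot] using this
  subst h₁
  obtain rfl := hy.unique (Stack.Runs.place (s := [a, b]) (t := [a, b])
    (w := ⟨[], .cross .virt a b, []⟩ :: twist k' b a (2 * m + 1)) ⟨rfl, runs_twist k' b a m⟩ l r)
  exact deforms_of_flat (hT' b a) p q l r hp hq D D' hD hD'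

end WeldedLink

theorem proposition7p4 {C : Type*} (n : ℕ) (hn : Odd n)
    (k k' : WeldedLink.Kind) (hk : k ≠ .virt) (hk' : k' ≠ .virt) (d d' : Bool) :
    WeldedLink.EquivalentMoves (WeldedLink.VMove C n k d) (WeldedLink.VBarMove C n k' d') :=
  ⟨WeldedLink.realizes_twistMove hn hk' hk _ _ _ _, WeldedLink.realizes_twistMove hn hk hk' _ _ _ _⟩
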